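/- Let $(s_t)_{t\ge 0}$ be a Markov chain on a finite state space $\mathcal S$ with irreducible transition matrix $P=(P_{s,j})$ and arbitrary initial law, and let $\mathcal A$ be a finite set of channels. For each state $j$ let $\mathcal T_j\subseteq\mathcal A$ be the set of channels that are idle in state $j$. For each state $s$ let $m_s\in\arg\max_{j\in\mathcal S}P_{s,j}$ (any fixed choice in case of ties), and for each predicted state $m_s$ let $q_{m_s}$ be a probability distribution on $\mathcal T_{m_s}$. Under the maximum-likelihood prediction-and-access policy, at each time $t$ with $s_t=s$ a channel $a_t=a\in\mathcal T_{m_s}$ is accessed with probability $q_{m_s}(a)$ given the past; the next state is $s_{t+1}=j$ with probability $P_{s,j}$ given the past and $a_t$ (the transitions do not depend on the actions). Given the past, $s_t$, $a_t$ and $s_{t+1}$, the reward $r_t$ is drawn from a law on $\mathbb R$ with finite mean that depends only on $(s_t,a_t,s_{t+1})$; its mean is $C_a$ if the accessed channel $a_t=a$ is idle in state $s_{t+1}$, i.e. $a\in\mathcal T_{s_{t+1}}$, and $0$ otherwise (collision). Then $P$ has a unique stationary distribution $\pi=\pi P$, and the limiting throughput exists almost surely and equals $$\lim_{n\to\infty}\frac1n\sum_{t=1}^{n}r_t\;\stackrel{a.s.}{=}\;\sum_{s\in\mathcal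 S}\pi_s\Big(P_{s,m_s}\sum_{a\in\mathcal T_{m_s}}q_{m_s}(a)\,C_a+\sum_{j\ne m_s}P_{s,j}\sum_{a\in\mathcal T_j\cap\mathcal T_{m_s}}q_{m_s}(a)\,C_a\Big).$$ -/

import Mathlib

open MeasureTheory Filter Topology

/-- `p` is a stationary distribution of the transition matrix `P`: a probability vector with
`p = p P`. -/
structure IsStationaryDistribution {S : Type*} [Fintype S] (P : Matrix S S ℝ) (p : S → ℝ) :
    Prop where
  nonneg : ∀ s, 0 ≤ p s
  sum_eq_one : ∑ s, p s = 1
  vecMul_eq : Matrix.vecMul p P = p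

/-- The information available when an action is chosen at time `t`: the σ-algebra generated by
the states, actions and rewards of the slots `k < t` and the current state `s_t`. -/
abbrev history {S A Ω : Type*} [MeasurableSpace S] [MeasurableSpace A]
    (s : ℕ → Ω → S) (a : ℕ → Ω → A) (r : ℕ → Ω → ℝ) (t : ℕ) : MeasurableSpace Ω :=
  (⨆ k : Fin t, MeasurableSpace.comap (fun ω => (s k ω, a k ω, r k ω)) inferInstance) ⊔
    MeasurableSpace.comap (s t) inferInstance

/-- `ρ i x j` is the law of the reward of a slot that starts in state `i`, in which channel `x`
is accessed, and which leads to state `j`. The expected reward is `C x` if channel `x` is idle in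
state `j` (that is, `x ∈ T j`) and zero if there is a collision. Rewards with a deterministic
value, and rewards that vanish identically at a collision, are included. -/
structure IsRewardLaw {S A : Type*} [DecidableEq A] (T : S → Finset A) (C : A → ℝ)
    (ρ : S → A → S → Measure ℝ) : Prop where
  isProbabilityMeasure : ∀ i x j, IsProbabilityMeasure (ρ i x j)
  integrable : ∀ i x j, Integrable (fun y : ℝ => y) (ρ i x j)
  mean : ∀ i x j, ∫ y, y ∂(ρ i x j) = if x ∈ T j then C x else 0

/-- The Markov environment with transition matrix `P` (not influenced by the actions) and reward
laws `ρ`, run under the randomized policy which in state `i` accesses channel `x` with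
probability `c i x`. The initial state has an arbitrary law. Given the history up to time `t`
with `s_t = i`, the action is `x` with probability `c i x`, the next state is `j` with probability
`P i j` whatever the action, and then the reward has law `ρ i x j`. -/
structure IsControlledProcess {S A Ω : Type*} [MeasurableSpace S] [MeasurableSpace A]
    [MeasurableSpace Ω] (P : Matrix S S ℝ) (c : S → A → ℝ) (ρ : S → A → S → Measure ℝ)
    (μ : Measure Ω) (s : ℕ → Ω → S) (a : ℕ → Ω → A) (r : ℕ → Ω → ℝ) : Prop where
  measurable_state : ∀ t, Measurable (s t)
  measurable_action : ∀ t, Measurable (a t)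
  measurable_reward : ∀ t, Measurable (r t)
  step : ∀ (t : ℕ) (E : Set Ω), MeasurableSet[history s a r t] E →
    ∀ (i : S) (x : A) (j : S) (B : Set ℝ), MeasurableSet B →
      μ.real (E ∩ {ω | s t ω = i ∧ a t ω = x ∧ s (t + 1) ω = j ∧ r t ω ∈ B}) =
        μ.real (E ∩ {ω | s t ω = i}) * c i x * P i j * (ρ i x j).real B

/-- `m` selects for every state a most likely next state, `m s ∈ argmax_j P s j`. -/
def IsMostLikelyNext {S : Type*} (P : Matrix S S ℝ) (m : S → S) : Prop :=
  ∀ s j, P s j ≤ P s (m s)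

/-- The maximum-likelihood prediction-and-access policy: in state `s` only channels that are idle
in the predicted state `m s` are accessed, channel `x ∈ T (m s)` with probability `q (m s) x`. -/
def mlPolicy {S A : Type*} [DecidableEq A] (T : S → Finset A) (m : S → S) (q : S → A → ℝ)
    (s : S) (x : A) : ℝ :=
  if x ∈ T (m s) then q (m s) x else 0

/-- `q j` is a probability distribution on the channels idle in state `j`. -/
def IsAccessDistribution {S A : Type*} (T : S → Finset A) (q : S → A → ℝ) (j : S) : Prop :=
  (∀ x ∈ T j, 0 ≤ q j x) ∧ ∑ x ∈ T j, q j x = 1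

/-! Given the history up to slot `t`, the mean of `r t` depends only on `s t`: it is `stepMean`
evaluated there. The average reward therefore splits into an average of centred rewards and an
average of a function of the state. The centred rewards are martingale differences, but only first
moments are available. So `r t` is truncated at level `t`: by Borel–Cantelli this alters finitely
many rewards, it changes the conditional means by a null sequence, and the variances of the
truncated rewards are summable against `1 / t ^ 2`. L²-martingale convergence and Kronecker's lemma
then give the limit zero (`ae_tendsto_average_reward_sub`). For the states, the Poisson equation `g
= f - P f + ∑ l, p l * g l` turns the sum of the centred `g (s t)` into a martingale plus a bounded
telescoping term (`ae_tendsto_average_state`). Irreducibility enters only through the maximum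
principle behind this equation, so periodic chains need no separate treatment; the same equation
yields uniqueness of `p`. -/

/-! ### Stationary distributions and the Poisson equation. -/

/-- A harmonic function of an irreducible stochastic matrix is constant. -/
theorem Matrix.IsIrreducible.eq_of_mulVec_eq {S : Type*} [Fintype S] [DecidableEq S]
    {P : Matrix S S ℝ} (hP : P ∈ Matrix.rowStochastic ℝ S) (hirr : P.IsIrreducible)
    {f : S → ℝ} (hf : P.mulVec f = f) (i j : S) : f i = f j := by
  have hpow : ∀ k : ℕ, (P ^ k).mulVec f = f := by
    intro k
    induction k with
    | zero => simp
    | succ k ih => rw [pow_succ, ← Matrix.mulVec_mulVec, hf, ih]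
  have : Nonempty S := ⟨i⟩
  -- Maximum principle: `f i₀` is a `P ^ k`-average of values at most `f i₀`, so every state of
  -- positive weight attains the maximum.
  obtain ⟨i₀, hi₀⟩ := Finite.exists_max f
  suffices h : ∀ j, f j = f i₀ by rw [h i, h j]
  intro j
  obtain ⟨k, -, hk⟩ :=
    (Matrix.isIrreducible_iff_exists_pow_pos hirr.nonneg).1 hirr i₀ j
  have hPk : P ^ k ∈ Matrix.rowStochastic ℝ S := pow_mem hP k
  have hsum : ∑ l, (P ^ k) i₀ l * (f i₀ - f l) = 0 := by
    have h1 : ∑ l, (P ^ k) i₀ l * f l = f i₀ := congrFun (hpow k) i₀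
    simp only [mul_sub, Finset.sum_sub_distrib, ← Finset.sum_mul, h1,
      Matrix.sum_row_of_mem_rowStochastic hPk, one_mul, sub_self]
  have hz := (Finset.sum_eq_zero_iff_of_nonneg (fun l _ =>
    mul_nonneg (Matrix.nonneg_of_mem_rowStochastic hPk) (sub_nonneg.2 (hi₀ l)))).1 hsum j
      (Finset.mem_univ j)
  rcases mul_eq_zero.1 hz with h | h
  · exact absurd h hk.ne'
  · linarith

/-- A stochastic matrix on a nonempty finite set has a stationary distribution. -/
theorem exists_isStationaryDistribution {S : Type*} [Fintype S] [DecidableEq S] [Nonempty S]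
    {P : Matrix S S ℝ} (hP : P ∈ Matrix.rowStochastic ℝ S) :
    ∃ p, IsStationaryDistribution P p := by
  -- The constant vector is a right eigenvector for eigenvalue 1, hence a left eigenvector `v`
  -- exists, possibly of mixed sign.
  have hdet : (1 - P).det = 0 := by
    refine Matrix.exists_mulVec_eq_zero_iff.1 ⟨1, one_ne_zero, ?_⟩
    rw [Matrix.sub_mulVec, Matrix.one_mulVec, hP.2, sub_self]
  obtain ⟨v, hv0, hv⟩ := Matrix.exists_vecMul_eq_zero_iff.2 hdet
  have hv : Matrix.vecMul v P = v := by
    rw [Matrix.vecMul_sub, Matrix.vecMul_one] at hv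
    exact (sub_eq_zero.1 hv).symm
  have hle : ∀ j, |v j| ≤ ∑ i, |v i| * P i j := by
    intro j
    have h1 : v j = ∑ i, v i * P i j := (congrFun hv j).symm
    rw [h1]
    refine (Finset.abs_sum_le_sum_abs _ _).trans (Finset.sum_le_sum fun i _ => ?_)
    rw [abs_mul, abs_of_nonneg (hP.1 i j)]
  have htot : ∑ j, ∑ i, |v i| * P i j = ∑ j, |v j| := by
    rw [Finset.sum_comm]
    simp [← Finset.mul_sum, Matrix.sum_row_of_mem_rowStochastic hP]
  -- `P` preserves total mass, so the entrywise inequalities `hle` must all be equalities and `|v|`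
  -- is invariant too.
  have heq : ∀ j, |v j| = ∑ i, |v i| * P i j := fun j =>
    (Finset.sum_eq_sum_iff_of_le fun j _ => hle j).1 htot.symm j (Finset.mem_univ j)
  have hpos : 0 < ∑ j, |v j| := by
    obtain ⟨j, hj⟩ := Function.ne_iff.1 hv0
    exact Finset.sum_pos' (fun _ _ => abs_nonneg _) ⟨j, Finset.mem_univ j, abs_pos.2 hj⟩
  refine ⟨fun j => |v j| / ∑ i, |v i|, fun j => by positivity, ?_, ?_⟩
  · rw [← Finset.sum_div, div_self hpos.ne']
  · funext j
    simp only [Matrix.vecMul, dotProduct, div_mul_eq_mul_div, ← Finset.sum_div, ← heq]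

theorem IsStationaryDistribution.sum_mul_mulVec {S : Type*} [Fintype S] {P : Matrix S S ℝ}
    {p : S → ℝ} (hp : IsStationaryDistribution P p) (f : S → ℝ) :
    ∑ l, p l * P.mulVec f l = ∑ l, p l * f l := by
  change p ⬝ᵥ P.mulVec f = p ⬝ᵥ f
  rw [Matrix.dotProduct_mulVec, hp.vecMul_eq]

/-- The Poisson equation of an irreducible stochastic matrix. -/
theorem IsStationaryDistribution.exists_poisson {S : Type*} [Fintype S] [DecidableEq S]
    {P : Matrix S S ℝ} (hP : P ∈ Matrix.rowStochastic ℝ S) (hirr : P.IsIrreducible)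
    {p : S → ℝ} (hp : IsStationaryDistribution P p) (g : S → ℝ) :
    ∃ f : S → ℝ, ∀ i, g i = f i - P.mulVec f i + ∑ l, p l * g l := by
  have hdot : ∀ f : S → ℝ, ∑ l, p l * (f l - P.mulVec f l) = 0 := by
    intro f
    simp only [mul_sub, Finset.sum_sub_distrib, hp.sum_mul_mulVec, sub_self]
  let L : (S → ℝ) →ₗ[ℝ] (S → ℝ) := LinearMap.id - P.mulVecLin
  have hL : ∀ f, L f = f - P.mulVec f := fun f => rfl
  have hker : ∀ f ∈ LinearMap.ker L, ∀ i j, f i = f j := fun f hf =>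
    hirr.eq_of_mulVec_eq hP (by
      rw [LinearMap.mem_ker, hL] at hf
      exact (sub_eq_zero.1 hf).symm)
  -- The kernel consists of constants and the range has `p`-mean zero, so they meet only in 0; by
  -- rank-nullity they span everything.
  have hdisj : Disjoint (LinearMap.range L) (LinearMap.ker L) := by
    rw [Submodule.disjoint_def]
    rintro _ ⟨f, rfl⟩ hf
    have h0 := hdot f
    funext i
    have h1 : ∀ l, f l - P.mulVec f l = L f i := fun l => hker _ hf l i
    simp only [h1, ← Finset.sum_mul, hp.sum_eq_one, one_mul] at h0
    exact h0
  have htop := Submodule.eq_top_of_disjoint _ _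
    (LinearMap.finrank_range_add_finrank_ker L).ge hdisj
  obtain ⟨_, ⟨f, rfl⟩, c, hc, hg⟩ := Submodule.mem_sup.1 (htop ▸ Submodule.mem_top : g ∈ _)
  refine ⟨f, fun i => ?_⟩
  have hgi : ∀ l, g l = (f l - P.mulVec f l) + c i := fun l => by
    rw [← hg, hker c hc i l]; rfl
  have : ∑ l, p l * g l = c i := by
    simp only [hgi, mul_add, Finset.sum_add_distrib, hdot, ← Finset.sum_mul, hp.sum_eq_one]
    simp
  rw [this, hgi i]

/-- For uniqueness, integrate the Poisson equation of the indicator of `i` against `p'`: the term `f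
- P f` vanishes and `p' i = p i` remains. -/
theorem existsUnique_isStationaryDistribution {S : Type*} [Fintype S] [DecidableEq S] [Nonempty S]
    {P : Matrix S S ℝ} (hP : P ∈ Matrix.rowStochastic ℝ S) (hirr : P.IsIrreducible) :
    ∃! p, IsStationaryDistribution P p := by
  obtain ⟨p, hp⟩ := exists_isStationaryDistribution hP
  refine ⟨p, hp, fun p' hp' => funext fun i => ?_⟩
  obtain ⟨f, hf⟩ := hp.exists_poisson hP hirr (Pi.single i 1)
  have h2 : ∑ l, p' l * Pi.single (M := fun _ => ℝ) i 1 l =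
      ∑ l, p l * Pi.single (M := fun _ => ℝ) i 1 l := by
    rw [Finset.sum_congr rfl fun l _ => congrArg (p' l * ·) (hf l)]
    simp only [mul_add, mul_sub, Finset.sum_add_distrib, Finset.sum_sub_distrib,
      hp'.sum_mul_mulVec, ← Finset.sum_mul, hp'.sum_eq_one, one_mul, sub_self, zero_add]
  simpa [Pi.single_apply] using h2

/-! ### Strong law for martingale differences. -/

/-- **Kronecker's lemma** for the weights `t`. -/
theorem tendsto_average_zero_of_tendsto_sum_div {d : ℕ → ℝ} {L : ℝ}
    (h : Tendsto (fun n => ∑ t ∈ Finset.range n, d t / t) atTop (𝓝 L)) :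
    Tendsto (fun n : ℕ => (n : ℝ)⁻¹ * ∑ t ∈ Finset.range n, d t) atTop (𝓝 0) := by
  set U : ℕ → ℝ := fun n => ∑ t ∈ Finset.range n, d t / t with hU
  -- Abel summation. The term `d 0` stands apart because `d 0 / 0 = 0` erases it from `U`.
  have key : ∀ n : ℕ, ∑ t ∈ Finset.range (n + 1), d t =
      d 0 + ((n + 1 : ℕ) : ℝ) * U (n + 1) - ∑ k ∈ Finset.range (n + 1), U (k + 1) := by
    intro n
    induction n with
    | zero => simp [hU]
    | succ n ih =>
      rw [Finset.sum_range_succ, ih, Finset.sum_range_succ (fun k => U (k + 1)) (n + 1)]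
      have : U (n + 1 + 1) = U (n + 1) + d (n + 1) / ((n + 1 : ℕ) : ℝ) :=
        Finset.sum_range_succ _ _
      rw [this]
      have : ((n + 1 : ℕ) : ℝ) ≠ 0 := by positivity
      push_cast at this ⊢
      field_simp
      ring
  have h1 : Tendsto (fun n : ℕ => (n : ℝ)⁻¹ * ∑ k ∈ Finset.range n, U (k + 1)) atTop (𝓝 L) :=
    (h.comp (tendsto_add_atTop_nat 1)).cesaro
  have h2 : Tendsto (fun n : ℕ => (n : ℝ)⁻¹ * d 0 + U n -
      (n : ℝ)⁻¹ * ∑ k ∈ Finset.range n, U (k + 1)) atTop (𝓝 (0 * d 0 + L - L)) :=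
    ((tendsto_inv_atTop_nhds_zero_nat.mul_const _).add h).sub h1
  rw [zero_mul, zero_add, sub_self] at h2
  refine h2.congr' ?_
  filter_upwards [eventually_ge_atTop 1] with n hn
  obtain ⟨n, rfl⟩ := Nat.exists_eq_add_of_le' hn
  rw [key]
  have : ((n + 1 : ℕ) : ℝ) ≠ 0 := by positivity
  field_simp

/-- Square-integrable martingale differences with bounded sum of variances are almost surely
summable. -/
theorem ae_exists_tendsto_sum_of_condExp_eq_zero {Ω : Type*} [m0 : MeasurableSpace Ω]
    {μ : Measure Ω} [IsProbabilityMeasure μ] {ℱ : Filtration ℕ m0} {d : ℕ → Ω → ℝ}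
    (hmeas : ∀ t, StronglyMeasurable[ℱ (t + 1)] (d t)) (hL2 : ∀ t, MemLp (d t) 2 μ)
    (hcond : ∀ t, μ[d t | ℱ t] =ᵐ[μ] 0) {K : ℝ}
    (hK : ∀ n, ∑ t ∈ Finset.range n, ∫ ω, d t ω ^ 2 ∂μ ≤ K) :
    ∀ᵐ ω ∂μ, ∃ L, Tendsto (fun n => ∑ t ∈ Finset.range n, d t ω) atTop (𝓝 L) := by
  set M : ℕ → Ω → ℝ := fun n => ∑ t ∈ Finset.range n, d t with hM
  have hMadp : StronglyAdapted ℱ M := fun n =>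
    Finset.stronglyMeasurable_sum _ fun t ht =>
      (hmeas t).mono (ℱ.mono (Finset.mem_range.1 ht))
  have hML2 : ∀ n, MemLp (M n) 2 μ := fun n => memLp_finsetSum' _ fun t _ => hL2 t
  have hsucc : ∀ n, M (n + 1) = M n + d n := fun n => Finset.sum_range_succ _ _
  have hmart : Martingale M ℱ μ := by
    refine martingale_of_condExp_sub_eq_zero_nat hMadp
      (fun n => (hML2 n).integrable one_le_two) fun n => ?_
    rw [hsucc, add_sub_cancel_left]
    exact hcond n
  -- Martingale increments are orthogonal in L², so variances add.
  have hsq : ∀ n, ∫ ω, M n ω ^ 2 ∂μ = ∑ t ∈ Finset.range n, ∫ ω, d t ω ^ 2 ∂μ := by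
    intro n
    induction n with
    | zero => simp [hM]
    | succ n ih =>
      have hcross : Integrable (M n * d n) μ := (hML2 n).integrable_mul (hL2 n)
      have h0 : ∫ ω, (M n * d n) ω ∂μ = 0 := by
        rw [← integral_condExp (ℱ.le n)]
        have h1 := condExp_mul_of_stronglyMeasurable_left (hMadp n) hcross
          ((hL2 n).integrable one_le_two)
        rw [integral_congr_ae h1]
        refine integral_eq_zero_of_ae ?_
        filter_upwards [hcond n] with ω hω
        simp [hω]
      rw [Finset.sum_range_succ, ← ih]
      have h2 : ∀ ω, M (n + 1) ω ^ 2 = M n ω ^ 2 + 2 * (M n * d n) ω + d n ω ^ 2 := by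
        intro ω
        rw [hsucc]
        simp only [Pi.add_apply, Pi.mul_apply]
        ring
      simp_rw [h2]
      have h3 : Integrable (fun ω => M n ω ^ 2 + 2 * (M n * d n) ω) μ :=
        (hML2 n).integrable_sq.add (hcross.const_mul 2)
      rw [integral_add h3 (hL2 n).integrable_sq,
        integral_add (hML2 n).integrable_sq (hcross.const_mul 2), integral_const_mul, h0]
      ring
  have hbdd : ∀ n, eLpNorm (M n) 1 μ ≤ ((1 + K).toNNReal : ENNReal) := by
    intro n
    have hint := (hML2 n).integrable one_le_two
    rw [eLpNorm_one_eq_lintegral_enorm, ← ofReal_integral_norm_eq_lintegral_enorm hint]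
    refine ENNReal.ofReal_le_ofReal ?_
    have h1 : ∫ ω, ‖M n ω‖ ∂μ ≤ ∫ ω, (1 + M n ω ^ 2) ∂μ := by
      refine integral_mono hint.norm ((integrable_const _).add (hML2 n).integrable_sq) fun ω => ?_
      rw [Real.norm_eq_abs]
      nlinarith [sq_abs (M n ω), sq_nonneg (|M n ω| - 1), abs_nonneg (M n ω)]
    rw [integral_add (integrable_const _) (hML2 n).integrable_sq, hsq] at h1
    simp only [integral_const, probReal_univ, smul_eq_mul, mul_one] at h1
    linarith [hK n]
  filter_upwards [hmart.submartingale.exists_ae_tendsto_of_bdd hbdd] with ω ⟨L, hL⟩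
  exact ⟨L, by simpa [hM] using hL⟩

/-- A strong law of large numbers for square-integrable martingale differences. -/
theorem ae_tendsto_average_zero_of_condExp_eq_zero {Ω : Type*} [m0 : MeasurableSpace Ω]
    {μ : Measure Ω} [IsProbabilityMeasure μ] {ℱ : Filtration ℕ m0} {d : ℕ → Ω → ℝ}
    (hmeas : ∀ t, StronglyMeasurable[ℱ (t + 1)] (d t)) (hL2 : ∀ t, MemLp (d t) 2 μ)
    (hcond : ∀ t, μ[d t | ℱ t] =ᵐ[μ] 0) {K : ℝ}
    (hK : ∀ n, ∑ t ∈ Finset.range n, ((t : ℝ) ^ 2)⁻¹ * ∫ ω, d t ω ^ 2 ∂μ ≤ K) :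
    ∀ᵐ ω ∂μ, Tendsto (fun n : ℕ => (n : ℝ)⁻¹ * ∑ t ∈ Finset.range n, d t ω) atTop (𝓝 0) := by
  have h := ae_exists_tendsto_sum_of_condExp_eq_zero (μ := μ) (ℱ := ℱ)
    (d := fun t => (t : ℝ)⁻¹ • d t) (K := K)
    (fun t => (hmeas t).const_smul _) (fun t => (hL2 t).const_smul _)
    (fun t => by
      filter_upwards [condExp_smul (μ := μ) (t : ℝ)⁻¹ (d t) (ℱ t), hcond t] with ω h1 h2
      rw [h1, Pi.smul_apply, h2]
      simp)
    (fun n => by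
      refine le_trans (le_of_eq (Finset.sum_congr rfl fun t _ => ?_)) (hK n)
      rw [← integral_const_mul]
      simp [mul_pow])
  filter_upwards [h] with ω ⟨L, hL⟩
  refine tendsto_average_zero_of_tendsto_sum_div (L := L) (hL.congr fun n => ?_)
  exact Finset.sum_congr rfl fun t _ => by simp [div_eq_inv_mul]

/-! ### Truncation estimates under a finite first moment. -/

theorem tsum_measure_le_abs_lt_top {Ω : Type*} [MeasurableSpace Ω] {ν : Measure Ω}
    [IsProbabilityMeasure ν] {X : Ω → ℝ} (hX : Integrable X ν) :
    ∑' t : ℕ, ν {ω | (t : ℝ) ≤ |X ω|} < ⊤ := by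
  let _ : MeasureSpace Ω := ⟨ν⟩
  have : IsProbabilityMeasure (volume : Measure Ω) := ‹IsProbabilityMeasure ν›
  -- The shift by 1 turns `t ≤ |X|` into the strict inequality `t < |X| + 1`.
  have h := ProbabilityTheory.tsum_prob_mem_Ioi_lt_top (X := fun ω => |X ω| + 1)
    (hX.abs.add (integrable_const _)) (fun ω => by positivity)
  refine lt_of_le_of_lt (ENNReal.tsum_le_tsum fun t => measure_mono fun ω hω => ?_) h
  simp only [Set.mem_ofPred_eq, Set.mem_Ioi] at hω ⊢
  linarith

/-- A value of size `y` contributes only for `t ≥ y`, where `∑ 1 / t ^ 2` is of order `1 / y`; this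
reduces `y ^ 2` to `y`. Passing to `|X|` gives access to the estimate for nonnegative variables. -/
theorem sum_integral_truncation_sq_le {Ω : Type*} [MeasurableSpace Ω] {ν : Measure Ω}
    [IsProbabilityMeasure ν] {X : Ω → ℝ} (hX : Integrable X ν) (n : ℕ) :
    ∑ t ∈ Finset.range n, ((t : ℝ) ^ 2)⁻¹ * ∫ ω, ProbabilityTheory.truncation X t ω ^ 2 ∂ν ≤
      2 * ∫ ω, |X ω| ∂ν := by
  let _ : MeasureSpace Ω := ⟨ν⟩
  have : IsProbabilityMeasure (volume : Measure Ω) := ‹IsProbabilityMeasure ν›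
  refine le_trans (Finset.sum_le_sum fun t _ => ?_)
    (ProbabilityTheory.sum_variance_truncation_le (X := fun ω => |X ω|) hX.abs
      (fun ω => abs_nonneg _) n)
  refine mul_le_mul_of_nonneg_left ?_ (by positivity)
  refine integral_mono_of_nonneg (Eventually.of_forall fun ω => sq_nonneg _)
    (hX.abs.aestronglyMeasurable.memLp_truncation (p := 2)).integrable_sq
    (Eventually.of_forall fun ω => ?_)
  simp only [ProbabilityTheory.truncation, Function.comp_apply, Set.indicator, id, Pi.pow_apply,
    Set.mem_Ioc]
  by_cases h : -(t : ℝ) < X ω ∧ X ω ≤ t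
  · have h' : |X ω| ≤ t := abs_le.2 ⟨h.1.le, h.2⟩
    have h0 : -(t : ℝ) < |X ω| := h.1.trans_le (le_abs_self _)
    rw [if_pos h, if_pos ⟨h0, h'⟩, sq_abs]
  · rw [if_neg h, zero_pow two_ne_zero]
    positivity

/-! ### The filtration and one-step conditional means. -/

/-- The σ-algebras `history s a r t` form a filtration. -/
def historyFiltration {S A Ω : Type*} [MeasurableSpace S] [MeasurableSpace A]
    [m0 : MeasurableSpace Ω] (s : ℕ → Ω → S) (a : ℕ → Ω → A) (r : ℕ → Ω → ℝ)
    (hs : ∀ t, Measurable (s t)) (ha : ∀ t, Measurable (a t)) (hr : ∀ t, Measurable (r t)) :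
    Filtration ℕ m0 where
  seq := history s a r
  mono' := by
    refine monotone_nat_of_le_succ fun t => sup_le (iSup_le fun k => ?_) ?_
    · exact le_sup_of_le_left (le_iSup_of_le k.castSucc le_rfl)
    · refine le_sup_of_le_left (le_iSup_of_le (Fin.last t) ?_)
      rintro _ ⟨B, hB, rfl⟩
      exact ⟨Prod.fst ⁻¹' B, measurable_fst hB, rfl⟩
  le' t := sup_le (iSup_le fun k => ((hs k).prodMk ((ha k).prodMk (hr k))).comap_le)
    (hs t).comap_le

theorem measurable_state_history {S A Ω : Type*} [MeasurableSpace S] [MeasurableSpace A]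
    (s : ℕ → Ω → S) (a : ℕ → Ω → A) (r : ℕ → Ω → ℝ) (t : ℕ) :
    Measurable[history s a r t] (s t) :=
  Measurable.mono (comap_measurable (s t)) le_sup_right le_rfl

theorem measurable_reward_history {S A Ω : Type*} [MeasurableSpace S] [MeasurableSpace A]
    (s : ℕ → Ω → S) (a : ℕ → Ω → A) (r : ℕ → Ω → ℝ) (t : ℕ) :
    Measurable[history s a r (t + 1)] (r t) := by
  have h : Measurable[history s a r (t + 1)] (fun ω => (s t ω, a t ω, r t ω)) :=
    Measurable.mono (comap_measurable _)
      (le_sup_of_le_left (le_iSup_of_le (Fin.last t) le_rfl)) le_rfl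
  exact measurable_snd.comp (measurable_snd.comp h)

/-- The expected value of `φ s_{t+1} r_t` given `s_t = i`. -/
noncomputable def stepMean {S A : Type*} [Fintype S] [Fintype A] (P : Matrix S S ℝ) (c : S → A → ℝ)
    (ρ : S → A → S → Measure ℝ) (φ : S → ℝ → ℝ) (i : S) : ℝ :=
  ∑ x, ∑ j, c i x * P i j * ∫ y, φ j y ∂ρ i x j

namespace IsControlledProcess

variable {S A Ω : Type*} {s : ℕ → Ω → S} {a : ℕ → Ω → A}

/-- The event that the transition of slot `t` starts in `k.1`, uses the action `k.2.1` and leads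
to `k.2.2`. -/
def transition (s : ℕ → Ω → S) (a : ℕ → Ω → A) (t : ℕ) (k : S × A × S) : Set Ω :=
  {ω | s t ω = k.1 ∧ a t ω = k.2.1 ∧ s (t + 1) ω = k.2.2}

theorem iUnion_inter_transition (t : ℕ) (E : Set Ω) :
    ⋃ k, E ∩ transition s a t k = E := by
  ext ω
  simp only [Set.mem_iUnion, Set.mem_inter_iff, transition, Set.mem_ofPred_eq]
  exact ⟨fun ⟨_, h, _⟩ => h, fun h => ⟨(s t ω, a t ω, s (t + 1) ω), h, rfl, rfl, rfl⟩⟩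

theorem pairwise_disjoint_transition (t : ℕ) (E : Set Ω) :
    Pairwise (Function.onFun Disjoint fun k => E ∩ transition s a t k) := by
  intro k k' hk
  refine Set.disjoint_left.2 fun ω h h' => hk ?_
  obtain ⟨-, h1, h2, h3⟩ := h
  obtain ⟨-, h1', h2', h3'⟩ := h'
  exact Prod.ext (h1 ▸ h1') (Prod.ext (h2 ▸ h2') (h3 ▸ h3'))

variable [MeasurableSpace S] [MeasurableSpace A] [m0 : MeasurableSpace Ω]
  {P : Matrix S S ℝ} {c : S → A → ℝ} {ρ : S → A → S → Measure ℝ} {μ : Measure Ω}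
  {r : ℕ → Ω → ℝ}

/-- The natural filtration of a controlled process. -/
def filtration (h : IsControlledProcess P c ρ μ s a r) : Filtration ℕ m0 :=
  historyFiltration s a r h.measurable_state h.measurable_action h.measurable_reward

theorem measureReal_transition (h : IsControlledProcess P c ρ μ s a r)
    (hρ : ∀ i x j, IsProbabilityMeasure (ρ i x j)) {t : ℕ} {E : Set Ω}
    (hE : MeasurableSet[history s a r t] E) (k : S × A × S) :
    μ.real (E ∩ transition s a t k) =
      μ.real (E ∩ {ω | s t ω = k.1}) * c k.1 k.2.1 * P k.1 k.2.2 := by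
  have := hρ k.1 k.2.1 k.2.2
  simpa [transition] using h.step t E hE k.1 k.2.1 k.2.2 Set.univ MeasurableSet.univ

/-- The identity `step`, read as a function of the Borel set `B`, is an equality of measures; in
this form it can be integrated against functions of the reward. -/
theorem map_restrict_transition [IsFiniteMeasure μ] (h : IsControlledProcess P c ρ μ s a r)
    (hρ : ∀ i x j, IsProbabilityMeasure (ρ i x j)) {t : ℕ} {E : Set Ω}
    (hE : MeasurableSet[history s a r t] E) (k : S × A × S) :
    (μ.restrict (E ∩ transition s a t k)).map (r t) =
      μ (E ∩ transition s a t k) • ρ k.1 k.2.1 k.2.2 := by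
  have := hρ k.1 k.2.1 k.2.2
  ext B hB
  have hstep := h.step t E hE k.1 k.2.1 k.2.2 B hB
  rw [← h.measureReal_transition hρ hE] at hstep
  rw [Measure.map_apply (h.measurable_reward t) hB,
    Measure.restrict_apply ((h.measurable_reward t) hB), Measure.smul_apply, smul_eq_mul,
    ← ENNReal.toReal_eq_toReal_iff' (by finiteness) (by finiteness), ENNReal.toReal_mul]
  simp only [← measureReal_def]
  rw [← hstep]
  congr 1
  ext ω
  simp only [transition, Set.mem_inter_iff, Set.mem_preimage, Set.mem_ofPred_eq]
  tauto

variable [MeasurableSingletonClass S]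

theorem setIntegral_comp_state [Fintype S] [IsFiniteMeasure μ]
    (h : IsControlledProcess P c ρ μ s a r) {t : ℕ} {E : Set Ω}
    (hE : MeasurableSet E) (g : S → ℝ) :
    ∫ ω in E, g (s t ω) ∂μ = ∑ i, μ.real (E ∩ {ω | s t ω = i}) * g i := by
  have hm : ∀ i, MeasurableSet (E ∩ {ω | s t ω = i}) := fun i =>
    hE.inter ((h.measurable_state t) (measurableSet_singleton i))
  have hU : ⋃ i, E ∩ {ω | s t ω = i} = E := by
    ext ω
    simp
  have hcongr : ∀ i, Set.EqOn (fun ω => g (s t ω)) (fun _ => g i) (E ∩ {ω | s t ω = i}) :=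
    fun i ω hω => congrArg g hω.2
  conv_lhs => rw [← hU]
  rw [integral_iUnion_fintype hm
    (fun i j hij => Set.disjoint_left.2 fun ω h1 h2 => hij (h1.2.symm.trans h2.2))
    fun i => ((integrable_const (g i)).integrableOn).congr_fun (hcongr i).symm (hm i)]
  exact Finset.sum_congr rfl fun i _ => by
    rw [setIntegral_congr_fun (hm i) (hcongr i), setIntegral_const, smul_eq_mul]

variable [MeasurableSingletonClass A]

theorem measurableSet_transition (h : IsControlledProcess P c ρ μ s a r) (t : ℕ)
    (k : S × A × S) : MeasurableSet (transition s a t k) :=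
  ((h.measurable_state t) (measurableSet_singleton k.1)).inter
    (((h.measurable_action t) (measurableSet_singleton k.2.1)).inter
      ((h.measurable_state (t + 1)) (measurableSet_singleton k.2.2)))

variable [IsFiniteMeasure μ]

theorem integrableOn_transition (h : IsControlledProcess P c ρ μ s a r)
    (hρ : ∀ i x j, IsProbabilityMeasure (ρ i x j)) {t : ℕ} {E : Set Ω}
    (hE : MeasurableSet[history s a r t] E) (k : S × A × S) {φ : S → ℝ → ℝ}
    (hφ : ∀ i x j, Integrable (φ j) (ρ i x j)) :
    IntegrableOn (fun ω => φ (s (t + 1) ω) (r t ω)) (E ∩ transition s a t k) μ := by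
  have hEm : MeasurableSet E := h.filtration.le t _ hE
  have h1 : Integrable (φ k.2.2) ((μ.restrict (E ∩ transition s a t k)).map (r t)) := by
    rw [h.map_restrict_transition hρ hE]
    exact (hφ _ _ _).smul_measure (by finiteness)
  have h2 := h1.comp_measurable (h.measurable_reward t)
  refine IntegrableOn.congr_fun (f := φ k.2.2 ∘ r t) h2 (fun ω hω => ?_)
    (hEm.inter (h.measurableSet_transition t k))
  simp only [Function.comp_apply, hω.2.2.2]

theorem setIntegral_transition (h : IsControlledProcess P c ρ μ s a r)
    (hρ : ∀ i x j, IsProbabilityMeasure (ρ i x j)) {t : ℕ} {E : Set Ω}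
    (hE : MeasurableSet[history s a r t] E) (k : S × A × S) {φ : S → ℝ → ℝ}
    (hφ : ∀ i x j, Integrable (φ j) (ρ i x j)) :
    ∫ ω in E ∩ transition s a t k, φ (s (t + 1) ω) (r t ω) ∂μ =
      μ.real (E ∩ transition s a t k) * ∫ y, φ k.2.2 y ∂ρ k.1 k.2.1 k.2.2 := by
  have hEm : MeasurableSet E := h.filtration.le t _ hE
  have h1 : Integrable (φ k.2.2) ((μ.restrict (E ∩ transition s a t k)).map (r t)) := by
    rw [h.map_restrict_transition hρ hE]
    exact (hφ _ _ _).smul_measure (by finiteness)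
  rw [setIntegral_congr_fun (g := fun ω => φ k.2.2 (r t ω))
    (hEm.inter (h.measurableSet_transition t k)) fun ω hω => by simp only [hω.2.2.2],
    ← integral_map (h.measurable_reward t).aemeasurable h1.aestronglyMeasurable,
    h.map_restrict_transition hρ hE, integral_smul_measure]
  rfl

variable [Fintype S] [Fintype A]

theorem integrable_step (h : IsControlledProcess P c ρ μ s a r)
    (hρ : ∀ i x j, IsProbabilityMeasure (ρ i x j)) (t : ℕ) {φ : S → ℝ → ℝ}
    (hφ : ∀ i x j, Integrable (φ j) (ρ i x j)) :
    Integrable (fun ω => φ (s (t + 1) ω) (r t ω)) μ := by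
  rw [← integrableOn_univ, ← iUnion_inter_transition (s := s) (a := a) t Set.univ,
    integrableOn_finite_iUnion]
  exact fun k => h.integrableOn_transition hρ MeasurableSet.univ k hφ

theorem setIntegral_step (h : IsControlledProcess P c ρ μ s a r)
    (hρ : ∀ i x j, IsProbabilityMeasure (ρ i x j)) {t : ℕ} {E : Set Ω}
    (hE : MeasurableSet[history s a r t] E) {φ : S → ℝ → ℝ}
    (hφ : ∀ i x j, Integrable (φ j) (ρ i x j)) :
    ∫ ω in E, φ (s (t + 1) ω) (r t ω) ∂μ =
      ∑ k : S × A × S, μ.real (E ∩ transition s a t k) * ∫ y, φ k.2.2 y ∂ρ k.1 k.2.1 k.2.2 := by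
  have hEm : MeasurableSet E := h.filtration.le t _ hE
  conv_lhs => rw [← iUnion_inter_transition (s := s) (a := a) t E]
  rw [integral_iUnion_fintype (fun k => hEm.inter (h.measurableSet_transition t k))
    (pairwise_disjoint_transition t E) fun k => h.integrableOn_transition hρ hE k hφ]
  exact Finset.sum_congr rfl fun k _ => h.setIntegral_transition hρ hE k hφ

/-- Decomposing a history event by transitions leaves, for each starting state, its mass times a
constant; that constant is `stepMean`, so the past enters only through `s t`. -/
theorem condExp_step (h : IsControlledProcess P c ρ μ s a r)
    (hρ : ∀ i x j, IsProbabilityMeasure (ρ i x j)) (t : ℕ) {φ : S → ℝ → ℝ}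
    (hφ : ∀ i x j, Integrable (φ j) (ρ i x j)) :
    μ[fun ω => φ (s (t + 1) ω) (r t ω) | h.filtration t] =ᵐ[μ]
      fun ω => stepMean P c ρ φ (s t ω) := by
  have hsm : StronglyMeasurable[h.filtration t] fun ω => stepMean P c ρ φ (s t ω) :=
    ((measurable_of_finite (stepMean P c ρ φ)).comp
      (measurable_state_history s a r t)).stronglyMeasurable
  have hint : Integrable (fun ω => stepMean P c ρ φ (s t ω)) μ :=
    Integrable.of_bound (hsm.mono (h.filtration.le t)).aestronglyMeasurable
      (∑ i, ‖stepMean P c ρ φ i‖) (Eventually.of_forall fun ω =>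
        Finset.single_le_sum (f := fun i => ‖stepMean P c ρ φ i‖) (fun _ _ => norm_nonneg _)
          (Finset.mem_univ _))
  refine (ae_eq_condExp_of_forall_setIntegral_eq (h.filtration.le t)
    (h.integrable_step hρ t hφ) (fun _ _ _ => hint.integrableOn) (fun E hE _ => ?_)
    hsm.aestronglyMeasurable).symm
  rw [h.setIntegral_step hρ hE hφ, h.setIntegral_comp_state (h.filtration.le t _ hE)]
  simp only [h.measureReal_transition hρ hE, Fintype.sum_prod_type, stepMean, Finset.mul_sum,
    mul_assoc]

end IsControlledProcess

/-! ### Strong laws along the process. -/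

namespace IsControlledProcess

variable {S A Ω : Type*} [Fintype S] [MeasurableSpace S] [MeasurableSingletonClass S]
  [Fintype A] [MeasurableSpace A] [MeasurableSingletonClass A] [m0 : MeasurableSpace Ω]
  {P : Matrix S S ℝ} {c : S → A → ℝ} {ρ : S → A → S → Measure ℝ} {μ : Measure Ω}
  [IsProbabilityMeasure μ] {s : ℕ → Ω → S} {a : ℕ → Ω → A} {r : ℕ → Ω → ℝ}

/-- Averages of square-integrable functions of the next state and the reward agree in the limit
with the averages of their conditional means. -/
theorem ae_tendsto_average_sub_stepMean (h : IsControlledProcess P c ρ μ s a r)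
    (hρ : ∀ i x j, IsProbabilityMeasure (ρ i x j)) {φ : ℕ → S → ℝ → ℝ}
    (hmeas : ∀ t j, Measurable (φ t j)) (hφ : ∀ t i x j, MemLp (φ t j) 2 (ρ i x j))
    {K : ℝ} (hK : ∀ i x j n,
      ∑ t ∈ Finset.range n, ((t : ℝ) ^ 2)⁻¹ * ∫ y, φ t j y ^ 2 ∂ρ i x j ≤ K) :
    ∀ᵐ ω ∂μ, Tendsto (fun n : ℕ => (n : ℝ)⁻¹ * ∑ t ∈ Finset.range n,
      (φ t (s (t + 1) ω) (r t ω) - stepMean P c ρ (φ t) (s t ω))) atTop (𝓝 0) := by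
  set Y : ℕ → Ω → ℝ := fun t ω => φ t (s (t + 1) ω) (r t ω) with hY
  set Z : ℕ → Ω → ℝ := fun t ω => stepMean P c ρ (φ t) (s t ω) with hZ
  have hint : ∀ t i x j, Integrable (φ t j) (ρ i x j) := fun t i x j =>
    have := hρ i x j
    (hφ t i x j).integrable one_le_two
  have hYm : ∀ t, Measurable[h.filtration (t + 1)] (Y t) := fun t =>
    (measurable_from_prod_countable_right (f := fun z : S × ℝ => φ t z.1 z.2) (hmeas t)).comp
      ((measurable_state_history s a r (t + 1)).prodMk (measurable_reward_history s a r t))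
  have hZm : ∀ t, Measurable[h.filtration t] (Z t) := fun t =>
    (measurable_of_finite (stepMean P c ρ (φ t))).comp (measurable_state_history s a r t)
  have hY2 : ∀ t, MemLp (Y t) 2 μ := fun t =>
    (memLp_two_iff_integrable_sq ((hYm t).mono (h.filtration.le _) le_rfl).aestronglyMeasurable).2
      (h.integrable_step hρ t (φ := fun j y => φ t j y ^ 2)
        fun i x j => (hφ t i x j).integrable_sq)
  have hcond : ∀ t, μ[Y t | h.filtration t] =ᵐ[μ] Z t := fun t => h.condExp_step hρ t (hint t)
  have hZ2 : ∀ t, MemLp (Z t) 2 μ := fun t => (MemLp.condExp one_le_two (hY2 t)).ae_eq (hcond t)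
  -- Centring does not increase the second moment, and each transition has mass at most 1; the bound
  -- then involves only the laws `ρ`.
  have hsq : ∀ t, ∫ ω, (Y t ω - Z t ω) ^ 2 ∂μ ≤
      ∑ k : S × A × S, ∫ y, φ t k.2.2 y ^ 2 ∂ρ k.1 k.2.1 k.2.2 := by
    intro t
    have h1 : ∫ ω, (Y t ω - Z t ω) ^ 2 ∂μ ≤ ∫ ω, Y t ω ^ 2 ∂μ := by
      have h2 : ∫ ω, (Y t ω - Z t ω) ^ 2 ∂μ =
          ∫ ω, (ProbabilityTheory.condVar (h.filtration t) (Y t) μ) ω ∂μ := by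
        rw [ProbabilityTheory.condVar, integral_condExp (h.filtration.le t)]
        refine integral_congr_ae ?_
        filter_upwards [hcond t] with ω hω
        simp [hω]
      rw [h2]
      refine (integral_mono_ae ProbabilityTheory.integrable_condVar integrable_condExp
        (ProbabilityTheory.condVar_ae_le_condExp_sq (h.filtration.le t) (hY2 t))).trans ?_
      rw [integral_condExp (h.filtration.le t)]
      rfl
    refine h1.trans ?_
    have h2 := h.setIntegral_step hρ (t := t) (E := Set.univ) MeasurableSet.univ
      (φ := fun j y => φ t j y ^ 2) fun i x j => (hφ t i x j).integrable_sq
    rw [setIntegral_univ] at h2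
    rw [h2]
    exact Finset.sum_le_sum fun k _ => mul_le_of_le_one_left
      (integral_nonneg fun y => sq_nonneg _) measureReal_le_one
  refine ae_tendsto_average_zero_of_condExp_eq_zero (ℱ := h.filtration)
    (d := fun t ω => Y t ω - Z t ω) (K := ∑ _k : S × A × S, K)
    (fun t => ((hYm t).sub ((hZm t).mono (h.filtration.mono t.le_succ) le_rfl)).stronglyMeasurable)
    (fun t => (hY2 t).sub (hZ2 t)) (fun t => ?_) fun n => ?_
  · have h1 := condExp_sub ((hY2 t).integrable one_le_two) ((hZ2 t).integrable one_le_two)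
      (h.filtration t)
    rw [condExp_of_stronglyMeasurable (h.filtration.le t) (hZm t).stronglyMeasurable
      ((hZ2 t).integrable one_le_two)] at h1
    filter_upwards [h1, hcond t] with ω h2 h3
    exact h2.trans (by simp [h3])
  · refine (Finset.sum_le_sum fun t _ =>
      mul_le_mul_of_nonneg_left (hsq t) (by positivity)).trans ?_
    simp only [Finset.mul_sum]
    rw [Finset.sum_comm]
    exact Finset.sum_le_sum fun k _ => hK _ _ _ n

/-- A crude bound, but uniform in `t`: it reduces Borel–Cantelli to tail sums of finitely many laws.
-/
theorem measure_reward_mem_le (h : IsControlledProcess P c ρ μ s a r)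
    (hρ : ∀ i x j, IsProbabilityMeasure (ρ i x j)) (t : ℕ) {B : Set ℝ} (hB : MeasurableSet B) :
    μ (r t ⁻¹' B) ≤ ∑ k : S × A × S, ρ k.1 k.2.1 k.2.2 B := by
  rw [← iUnion_inter_transition (s := s) (a := a) t (r t ⁻¹' B)]
  refine (measure_iUnion_fintype_le _ _).trans (Finset.sum_le_sum fun k _ => ?_)
  have h1 := congrArg (fun ν : Measure ℝ => ν B)
    (h.map_restrict_transition hρ (t := t) (E := Set.univ) MeasurableSet.univ k)
  simp only [Measure.map_apply (h.measurable_reward t) hB, Set.univ_inter,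
    Measure.restrict_apply ((h.measurable_reward t) hB), Measure.smul_apply, smul_eq_mul] at h1
  rw [h1]
  exact mul_le_of_le_one_left zero_le prob_le_one

theorem ae_eventually_abs_reward_lt (h : IsControlledProcess P c ρ μ s a r)
    (hρ : ∀ i x j, IsProbabilityMeasure (ρ i x j))
    (hint : ∀ i x j, Integrable (fun y : ℝ => y) (ρ i x j)) :
    ∀ᵐ ω ∂μ, ∀ᶠ t : ℕ in atTop, |r t ω| < t := by
  have hfin : ∑' t : ℕ, μ {ω | (t : ℝ) ≤ |r t ω|} ≠ ⊤ := by
    refine ne_top_of_le_ne_top ?_ (ENNReal.tsum_le_tsum fun t => h.measure_reward_mem_le hρ t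
      (B := {y | (t : ℝ) ≤ |y|}) (measurableSet_le measurable_const measurable_norm))
    rw [Summable.tsum_finsetSum fun _ _ => ENNReal.summable]
    exact (ENNReal.sum_lt_top.2 fun k _ =>
      have := hρ k.1 k.2.1 k.2.2
      tsum_measure_le_abs_lt_top (hint k.1 k.2.1 k.2.2)).ne
  filter_upwards [ae_eventually_notMem hfin] with ω hω
  filter_upwards [hω] with t ht
  simpa using ht

/-- The averages of the rewards and of their conditional means have the same limit. -/
theorem ae_tendsto_average_reward_sub (h : IsControlledProcess P c ρ μ s a r)
    (hρ : ∀ i x j, IsProbabilityMeasure (ρ i x j))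
    (hint : ∀ i x j, Integrable (fun y : ℝ => y) (ρ i x j)) :
    ∀ᵐ ω ∂μ, Tendsto (fun n : ℕ => (n : ℝ)⁻¹ * ∑ t ∈ Finset.range n,
      (r t ω - stepMean P c ρ (fun _ y => y) (s t ω))) atTop (𝓝 0) := by
  let φ : ℕ → S → ℝ → ℝ := fun t _ => ProbabilityTheory.truncation (fun y => y) t
  have hmean : ∀ i, Tendsto (fun t : ℕ => stepMean P c ρ (φ t) i) atTop
      (𝓝 (stepMean P c ρ (fun _ y => y) i)) := fun i =>
    tendsto_finsetSum _ fun x _ => tendsto_finsetSum _ fun j _ =>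
      ((ProbabilityTheory.tendsto_integral_truncation (hint i x j)).comp
        tendsto_natCast_atTop_atTop).const_mul _
  have htrunc := h.ae_tendsto_average_sub_stepMean hρ (φ := φ)
    (K := ∑ k : S × A × S, 2 * ∫ y, |y| ∂ρ k.1 k.2.1 k.2.2)
    (fun t j => (measurable_id.indicator measurableSet_Ioc).comp measurable_id)
    (fun t i x j =>
      have := hρ i x j
      (hint i x j).aestronglyMeasurable.memLp_truncation)
    fun i x j n => by
      have := hρ i x j
      refine (sum_integral_truncation_sq_le (hint i x j) n).trans ?_
      exact Finset.single_le_sum (f := fun k : S × A × S => 2 * ∫ y, |y| ∂ρ k.1 k.2.1 k.2.2)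
        (fun k _ => by positivity) (Finset.mem_univ (i, x, j))
  filter_upwards [htrunc, h.ae_eventually_abs_reward_lt hρ hint] with ω h1 h2
  have h3 : Tendsto (fun t => r t ω - φ t (s (t + 1) ω) (r t ω)) atTop (𝓝 0) := by
    refine tendsto_const_nhds.congr' ?_
    filter_upwards [h2] with t ht
    rw [show φ t (s (t + 1) ω) (r t ω) = r t ω from ProbabilityTheory.truncation_eq_self ht,
      sub_self]
  have h4 : Tendsto (fun t => stepMean P c ρ (φ t) (s t ω) -
      stepMean P c ρ (fun _ y => y) (s t ω)) atTop (𝓝 0) := by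
    have h5 : Tendsto (fun t => ∑ i, |stepMean P c ρ (φ t) i - stepMean P c ρ (fun _ y => y) i|)
        atTop (𝓝 (∑ _i : S, 0)) :=
      tendsto_finsetSum _ fun i _ => by
        simpa using ((hmean i).sub_const (stepMean P c ρ (fun _ y => y) i)).abs
    rw [Finset.sum_const_zero] at h5
    refine squeeze_zero_norm (fun t => ?_) h5
    exact Finset.single_le_sum
      (f := fun i => |stepMean P c ρ (φ t) i - stepMean P c ρ (fun _ y => y) i|)
      (fun _ _ => abs_nonneg _) (Finset.mem_univ _)
  -- Centred truncated rewards, truncation error and shift of the conditional mean add up to the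
  -- centred reward.
  have h6 := (h1.add h3.cesaro).add h4.cesaro
  rw [add_zero, add_zero] at h6
  refine h6.congr fun n => ?_
  rw [← mul_add, ← mul_add, ← Finset.sum_add_distrib, ← Finset.sum_add_distrib]
  congr 1
  exact Finset.sum_congr rfl fun t _ => by ring

/-- The ergodic theorem for the state chain. -/
theorem ae_tendsto_average_state [DecidableEq S] (h : IsControlledProcess P c ρ μ s a r)
    (hρ : ∀ i x j, IsProbabilityMeasure (ρ i x j)) (hP : P ∈ Matrix.rowStochastic ℝ S)
    (hirr : P.IsIrreducible) (hc : ∀ i, ∑ x, c i x = 1) {p : S → ℝ}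
    (hp : IsStationaryDistribution P p) (g : S → ℝ) :
    ∀ᵐ ω ∂μ, Tendsto (fun n : ℕ => (n : ℝ)⁻¹ * ∑ t ∈ Finset.range n, g (s t ω)) atTop
      (𝓝 (∑ i, p i * g i)) := by
  obtain ⟨f, hf⟩ := hp.exists_poisson hP hirr g
  have hmean : ∀ i, stepMean P c ρ (fun j _ => f j) i = P.mulVec f i := by
    intro i
    have h1 : ∀ x j, ∫ _, f j ∂ρ i x j = f j := fun x j => by
      have := hρ i x j
      simp
    simp only [stepMean, h1, mul_assoc, ← Finset.mul_sum, ← Finset.sum_mul, hc, one_mul]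
    rfl
  have hsum : Summable fun t : ℕ => ((t : ℝ) ^ 2)⁻¹ := Real.summable_nat_pow_inv.2 one_lt_two
  have hdiff := h.ae_tendsto_average_sub_stepMean hρ (φ := fun _ j _ => f j)
    (K := (∑' t : ℕ, ((t : ℝ) ^ 2)⁻¹) * ∑ j, f j ^ 2)
    (fun _ _ => measurable_const)
    (fun _ i x j =>
      have := hρ i x j
      memLp_const _)
    fun i x j n => by
      have := hρ i x j
      simp only [integral_const, probReal_univ, one_smul, ← Finset.sum_mul]
      exact mul_le_mul (hsum.sum_le_tsum _ fun t _ => by positivity)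
        (Finset.single_le_sum (f := fun j => f j ^ 2) (fun _ _ => sq_nonneg _)
          (Finset.mem_univ j)) (sq_nonneg _) (tsum_nonneg fun t => by positivity)
  filter_upwards [hdiff] with ω h1
  have h2 : Tendsto (fun n : ℕ => (n : ℝ)⁻¹ * (f (s 0 ω) - f (s n ω))) atTop (𝓝 0) := by
    have h3 : Tendsto (fun n : ℕ => (n : ℝ)⁻¹ * (2 * ∑ i, |f i|)) atTop (𝓝 0) := by
      simpa using (tendsto_inv_atTop_nhds_zero_nat (𝕜 := ℝ)).mul_const (2 * ∑ i, |f i|)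
    refine squeeze_zero_norm (fun n => ?_) h3
    have hb : ∀ i, |f i| ≤ ∑ i, |f i| := fun i =>
      Finset.single_le_sum (f := fun i => |f i|) (fun _ _ => abs_nonneg _) (Finset.mem_univ i)
    rw [norm_mul, Real.norm_of_nonneg (by positivity), Real.norm_eq_abs]
    refine mul_le_mul_of_nonneg_left ?_ (by positivity)
    linarith [abs_sub (f (s 0 ω)) (f (s n ω)), hb (s 0 ω), hb (s n ω)]
  have h4 := (h1.add h2).add_const (∑ l, p l * g l)
  rw [add_zero, zero_add] at h4
  refine h4.congr' ?_
  filter_upwards [eventually_ge_atTop 1] with n hn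
  have hn' : (n : ℝ) ≠ 0 := by positivity
  -- Adding and subtracting `f (s (t + 1))` in the Poisson equation separates the martingale
  -- difference from the telescoping part.
  have h5 : ∑ t ∈ Finset.range n, g (s t ω) = ∑ t ∈ Finset.range n,
      (f (s (t + 1) ω) - stepMean P c ρ (fun j _ => f j) (s t ω)) +
      (f (s 0 ω) - f (s n ω)) + n * ∑ l, p l * g l := by
    rw [← Finset.sum_range_sub' (fun t => f (s t ω)), ← Finset.sum_add_distrib]
    have h6 : (n : ℝ) * ∑ l, p l * g l = ∑ t ∈ Finset.range n, ∑ l, p l * g l := by simp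
    rw [h6, ← Finset.sum_add_distrib]
    refine Finset.sum_congr rfl fun t _ => ?_
    rw [hmean, hf (s t ω)]
    ring
  rw [h5]
  field_simp

/-- The strong law of large numbers for the rewards of a controlled process. -/
theorem ae_tendsto_average_reward [DecidableEq S] (h : IsControlledProcess P c ρ μ s a r)
    (hρ : ∀ i x j, IsProbabilityMeasure (ρ i x j))
    (hint : ∀ i x j, Integrable (fun y : ℝ => y) (ρ i x j)) (hP : P ∈ Matrix.rowStochastic ℝ S)
    (hirr : P.IsIrreducible) (hc : ∀ i, ∑ x, c i x = 1) {p : S → ℝ}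
    (hp : IsStationaryDistribution P p) :
    ∀ᵐ ω ∂μ, Tendsto (fun n : ℕ => (1 / (n : ℝ)) * ∑ t ∈ Finset.Icc 1 n, r t ω) atTop
      (𝓝 (∑ i, p i * stepMean P c ρ (fun _ y => y) i)) := by
  filter_upwards [h.ae_tendsto_average_reward_sub hρ hint,
    h.ae_tendsto_average_state hρ hP hirr hc hp (stepMean P c ρ (fun _ y => y))] with ω h1 h2
  have h3 := h1.add h2
  rw [zero_add] at h3
  have h4 : Tendsto (fun n : ℕ => (n : ℝ)⁻¹ * ∑ t ∈ Finset.range n, r t ω) atTop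
      (𝓝 (∑ i, p i * stepMean P c ρ (fun _ y => y) i)) := by
    refine h3.congr fun n => ?_
    rw [← mul_add, ← Finset.sum_add_distrib]
    simp
  -- Passage from the slots `0, …, n` to `1, …, n`: rescale by `(n + 1) / n` and discard `r 0`.
  have h5 : Tendsto (fun n : ℕ => (1 + (n : ℝ)⁻¹) *
      (((n + 1 : ℕ) : ℝ)⁻¹ * ∑ t ∈ Finset.range (n + 1), r t ω) - (n : ℝ)⁻¹ * r 0 ω) atTop
      (𝓝 ((1 + 0) * (∑ i, p i * stepMean P c ρ (fun _ y => y) i) - 0 * r 0 ω)) :=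
    ((tendsto_inv_atTop_nhds_zero_nat.const_add 1).mul
      (h4.comp (tendsto_add_atTop_nat 1))).sub (tendsto_inv_atTop_nhds_zero_nat.mul_const _)
  rw [add_zero, one_mul, zero_mul, sub_zero] at h5
  refine h5.congr' ?_
  filter_upwards [eventually_ge_atTop 1] with n hn
  have hn' : (n : ℝ) ≠ 0 := by positivity
  have h6 : ∑ t ∈ Finset.range (n + 1), r t ω = r 0 ω + ∑ t ∈ Finset.Icc 1 n, r t ω := by
    rw [Finset.range_eq_Ico, Finset.sum_eq_sum_Ico_succ_bot n.succ_pos]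
    rfl
  have hn1 : (n : ℝ) + 1 ≠ 0 := by positivity
  rw [h6]
  push_cast
  field_simp
  ring

end IsControlledProcess

/-! ### The throughput of the maximum-likelihood policy. -/

theorem sum_mlPolicy {S A : Type*} [Fintype A] [DecidableEq A] {T : S → Finset A} {m : S → S}
    {q : S → A → ℝ} (hq : ∀ s, IsAccessDistribution T q (m s)) (i : S) :
    ∑ x, mlPolicy T m q i x = 1 := by
  simpa [mlPolicy, Finset.sum_ite_mem] using (hq i).2

/-- A channel contributes for next state `j` only if it is both allowed by the prediction and idle
in `j`; for `j = m i` the two conditions coincide, which isolates the first term. -/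
theorem stepMean_mlPolicy {S A : Type*} [Fintype S] [DecidableEq S] [Fintype A] [DecidableEq A]
    (P : Matrix S S ℝ) {T : S → Finset A} {C : A → ℝ} {ρ : S → A → S → Measure ℝ}
    (hρ : IsRewardLaw T C ρ) (m : S → S) (q : S → A → ℝ) (i : S) :
    stepMean P (mlPolicy T m q) ρ (fun _ y => y) i =
      P i (m i) * ∑ x ∈ T (m i), q (m i) x * C x +
        ∑ j ∈ Finset.univ.erase (m i), P i j * ∑ x ∈ T j ∩ T (m i), q (m i) x * C x := by
  have h1 : stepMean P (mlPolicy T m q) ρ (fun _ y => y) i =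
      ∑ j, P i j * ∑ x ∈ T j ∩ T (m i), q (m i) x * C x := by
    rw [stepMean, Finset.sum_comm]
    refine Finset.sum_congr rfl fun j _ => ?_
    rw [Finset.mul_sum, ← Finset.sum_subset (Finset.subset_univ (T j ∩ T (m i)))]
    · refine Finset.sum_congr rfl fun x hx => ?_
      rw [Finset.mem_inter] at hx
      rw [hρ.mean, if_pos hx.1, mlPolicy, if_pos hx.2]
      ring
    · intro x _ hx
      rw [Finset.mem_inter, not_and_or] at hx
      rw [hρ.mean, mlPolicy]
      rcases hx with hx | hx <;> simp [hx]
  rw [h1, ← Finset.add_sum_erase _ _ (Finset.mem_univ (m i)), Finset.inter_self]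

theorem theorem3 {S A Ω : Type*} [Fintype S] [DecidableEq S]
    [MeasurableSpace S] [MeasurableSingletonClass S]
    [Fintype A] [DecidableEq A] [MeasurableSpace A] [MeasurableSingletonClass A]
    [MeasurableSpace Ω] (μ : Measure Ω) [IsProbabilityMeasure μ]
    (P : Matrix S S ℝ) (hP : P ∈ Matrix.rowStochastic ℝ S) (hirr : P.IsIrreducible)
    (T : S → Finset A) (C : A → ℝ)
    (ρ : S → A → S → Measure ℝ) (hρ : IsRewardLaw T C ρ)
    (m : S → S) (hm : IsMostLikelyNext P m)
    (q : S → A → ℝ) (hq : ∀ s, IsAccessDistribution T q (m s))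
    (s : ℕ → Ω → S) (a : ℕ → Ω → A) (r : ℕ → Ω → ℝ)
    (hproc : IsControlledProcess P (mlPolicy T m q) ρ μ s a r) :
    (∃! p : S → ℝ, IsStationaryDistribution P p) ∧
    ∀ p : S → ℝ, IsStationaryDistribution P p →
      ∀ᵐ ω ∂μ, Tendsto (fun n : ℕ => (1 / (n : ℝ)) * ∑ t ∈ Finset.Icc 1 n, r t ω) atTop
        (𝓝 (∑ i, p i *
          (P i (m i) * ∑ x ∈ T (m i), q (m i) x * C x +
            ∑ j ∈ Finset.univ.erase (m i),
              P i j * ∑ x ∈ T j ∩ T (m i), q (m i) x * C x))) := by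
  have : Nonempty S := (nonempty_of_isProbabilityMeasure μ).map (s 0)
  refine ⟨existsUnique_isStationaryDistribution hP hirr, fun p hp => ?_⟩
  have h := hproc.ae_tendsto_average_reward hρ.isProbabilityMeasure hρ.integrable hP hirr
    (sum_mlPolicy hq) hp
  simpa only [stepMean_mlPolicy P hρ] using h
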